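/- A free ultrafilter $p$ on $\omega$ is \emph{Ramsey} if for every partition $\{P_n:n\in\omega\}$ of $\omega$ into infinitely many nonempty pieces either $P_i\in p$ for some $i\in\omega$, or there is $U\in p$ with $|U\cap P_i|=1$ for every $i\in\omega$. For a free ultrafilter $p$ on $\omega$, a set $A\subseteq\omega$ and points $x_n$ $(n\in A)$ of a topological space $X$, a point $x\in X$ is the \emph{$p$-limit} of $(x_n)_{n\in A}$ if $\{n\in A:x_n\in U\}\in p$ for every open neighborhood $U$ of $x$. A point $x\in X$ is the \emph{double $p$-limit} of a double sequence $\{x_{n,m}:n<m<\omega\}\subseteq X$ if there are $A\in p$ and points $x_n\in X$ $(n\in A)$ such that $x_n$ is the $p$-limit of $(x_{n,m})_{m>n}$ for every $n\in A$ and $x$ is the $p$-limit of $(x_n)_{n\in A}$. A space $X$ is \emph{doubly countably compact} if every double sequence in $X$ has a double $p$-limit in $X$ for some free ultrafilter $p$ on $\omega$. \textbf{Theorem.} Assume that a Ramsey ultrafilter exists. Then there is a Tychonoff (completely regular Hausdorff) doubly countably compact space $X$ whose square $X\times X$ is not countably compact. -/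

import Mathlib

open Topology

/-- An ultrafilter on `ℕ` is free if it contains every cofinite set. -/
def IsFreeUltrafilter (p : Ultrafilter ℕ) : Prop :=
  ∀ S : Set ℕ, Sᶜ.Finite → S ∈ p

/-- A Ramsey ultrafilter: a free ultrafilter `p` on `ℕ` such that for every partition of `ℕ` into
countably infinitely many (nonempty, pairwise disjoint) pieces `P i`, either some piece is in `p`
or some member of `p` meets every piece in exactly one point. -/
def IsRamseyUltrafilter (p : Ultrafilter ℕ) : Prop :=
  IsFreeUltrafilter p ∧
    ∀ P : ℕ → Set ℕ, (∀ i, (P i).Nonempty) → (∀ i j, i ≠ j → Disjoint (P i) (P j)) →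
      (⋃ i, P i) = Set.univ →
        (∃ i, P i ∈ p) ∨ ∃ U ∈ p, ∀ i, ∃! n, n ∈ U ∩ P i

/-- `x` is the `p`-limit of the sequence `s`, indexed by a set `A` of natural numbers: for every
open neighbourhood `U` of `x`, the set of those `n ∈ A` with `s n ∈ U` belongs to `p`. -/
def IsPLimit {X : Type*} [TopologicalSpace X] (p : Ultrafilter ℕ) {A : Set ℕ} (s : A → X)
    (x : X) : Prop :=
  ∀ U : Set X, IsOpen U → x ∈ U → {n : ℕ | ∃ h : n ∈ A, s ⟨n, h⟩ ∈ U} ∈ p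

/-- `x` is the double `p`-limit of the double sequence `f n m`, `n < m` (the row `f n` is indexed
by the `m` in `Set.Ioi n`). -/
def IsDoublePLimit {X : Type*} [TopologicalSpace X] (p : Ultrafilter ℕ)
    (f : (n : ℕ) → Set.Ioi n → X) (x : X) : Prop :=
  ∃ A : Set ℕ, A ∈ p ∧ ∃ y : A → X, (∀ n : A, IsPLimit p (f n) (y n)) ∧ IsPLimit p y x

/-- A space is doubly countably compact if every double sequence in it has a double `p`-limit
for some free ultrafilter `p`. -/
def DoublyCountablyCompact (X : Type*) [TopologicalSpace X] : Prop :=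
  ∀ f : (n : ℕ) → Set.Ioi n → X,
    ∃ p : Ultrafilter ℕ, IsFreeUltrafilter p ∧ ∃ x : X, IsDoublePLimit p f x

/-! ### Free ultrafilters, diagonal sets and almost disjoint families -/

namespace DoubleLimit

open Filter Set Cardinal

/-! Let `W` be two disjoint copies of `ℕ` and `τ` the involution swapping them. The space is a set
`Z` of ultrafilters on `W`, with the topology of the Stone space, that contains all principal ones
and contains `u` and `u.map τ` together only for principal `u`. Then the points `(w, τ w)` cannot
accumulate in `Z × Z`: a cluster point would be of the form `(u, u.map τ)`, so `u` would be
principal, that is, isolated (`not_countablyCompactSpace_prod`).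

`Z` is built in continuum many steps, each adding a double limit of one double sequence from the
earlier points; limits along `p` are given by `Ultrafilter.bind`. The crux is
`exists_free_bind_avoiding`: fewer than continuum many forbidden points can be avoided. After
thinning (`exists_thinning`), each row, and the sequence of row limits, has limits that are either
terms of the double sequence or pairwise distinct along ultrafilters living on almost disjoint sets.
There are continuum many such sets, so some choice avoids every forbidden point that is not a term.
-/

theorem _root_.IsFreeUltrafilter.eventually_gt {p : Ultrafilter ℕ} (hp : IsFreeUltrafilter p)
    (n : ℕ) : ∀ᶠ m in (p : Filter ℕ), n < m :=
  hp (Ioi n) (by simp)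

theorem exists_isFreeUltrafilter_mem {A : Set ℕ} (hA : A.Infinite) :
    ∃ r : Ultrafilter ℕ, IsFreeUltrafilter r ∧ A ∈ r := by
  have : (cofinite ⊓ 𝓟 A).NeBot := cofinite_inf_principal_neBot_iff.2 hA
  refine ⟨Ultrafilter.of (cofinite ⊓ 𝓟 A), fun S hS => ?_, ?_⟩
  · exact (Ultrafilter.of_le _) (mem_inf_of_left hS)
  · exact (Ultrafilter.of_le _) (mem_inf_of_right (mem_principal_self A))

theorem mem_bind_iff {ι W : Type*} {p : Ultrafilter ι} {u : ι → Ultrafilter W} {s : Set W} :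
    s ∈ p.bind u ↔ ∀ᶠ i in (p : Filter ι), s ∈ u i := Iff.rfl

theorem eventually_mem_iff_mem_bind {ι W : Type*} (p : Ultrafilter ι) (u : ι → Ultrafilter W)
    (s : Set W) : ∀ᶠ i in (p : Filter ι), (s ∈ p.bind u ↔ s ∈ u i) := by
  by_cases h : s ∈ p.bind u
  · exact (mem_bind_iff.1 h).mono fun i hi => ⟨fun _ => hi, fun _ => h⟩
  · have h' := h
    rw [mem_bind_iff, ← Ultrafilter.eventually_not] at h'
    exact h'.mono fun i hi => ⟨fun h1 => (h h1).elim, fun h1 => (hi h1).elim⟩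

theorem exists_mem_notMem_of_ne {W : Type*} {u v : Ultrafilter W} (h : u ≠ v) :
    ∃ s, s ∈ u ∧ s ∉ v := by
  by_contra! H
  exact h (Ultrafilter.coe_le_coe.1 fun s hs => H s hs).symm

/-- Diagonalization along a free ultrafilter. -/
theorem exists_infinite_diagonal {p : Ultrafilter ℕ} (hp : IsFreeUltrafilter p) {A : Set ℕ}
    (hA : A ∈ p) {R : ℕ → ℕ → Prop} (hR : ∀ n, ∀ᶠ m in (p : Filter ℕ), R n m) :
    ∃ H ⊆ A, H.Infinite ∧ ∀ n ∈ H, ∀ m ∈ H, n < m → R n m := by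
  obtain ⟨h, hhA, hh⟩ := exists_seq_of_forall_finset_exists (· ∈ A) (fun n m => n < m ∧ R n m)
    (fun s _ => by
      have h1 : ∀ᶠ m in (p : Filter ℕ), ∀ n ∈ s, n < m ∧ R n m :=
        (eventually_all_finset s).2 fun n _ => (hp.eventually_gt n).and (hR n)
      exact (Filter.Eventually.and hA h1).exists)
  have hmono : StrictMono h := fun i j hij => (hh i j hij).1
  refine ⟨range h, range_subset_iff.2 hhA, infinite_range_of_injective hmono.injective, ?_⟩
  rintro _ ⟨i, rfl⟩ _ ⟨j, rfl⟩ hij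
  exact (hh i j (hmono.lt_iff_lt.1 hij)).2

/-- Every infinite set of natural numbers contains an almost disjoint family of infinite sets
of size continuum. -/
theorem exists_almost_disjoint {H : Set ℕ} (hH : H.Infinite) :
    ∃ A : (ℕ → Bool) → Set ℕ, (∀ a, A a ⊆ H) ∧ (∀ a, (A a).Infinite) ∧
      ∀ a b, a ≠ b → (A a ∩ A b).Finite := by
  have := hH.to_subtype
  let e : List Bool → ℕ := fun l => (Infinite.natEmbedding H (Encodable.encode l) : ℕ)
  have he : Function.Injective e :=
    Subtype.val_injective.comp ((Infinite.natEmbedding H).injective.comp Encodable.encode_injective)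
  -- Branches of the binary tree: `g a n` codes the first `n` bits of `a`, and two branches share
  -- only the nodes up to their splitting point.
  let g : (ℕ → Bool) → ℕ → ℕ := fun a n => e ((List.range n).map a)
  have hg : ∀ a b n m, g a n = g b m → n = m ∧ ∀ k < n, a k = b k := by
    intro a b n m h
    have h1 := he h
    have h2 : n = m := by simpa using congrArg List.length h1
    subst h2
    refine ⟨rfl, fun k hk => ?_⟩
    exact List.map_inj_left.1 h1 k (List.mem_range.2 hk)
  refine ⟨fun a => range (g a), fun a => ?_, fun a => ?_, fun a b hab => ?_⟩
  · rintro _ ⟨n, rfl⟩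
    exact Subtype.property _
  · exact infinite_range_of_injective fun n m h => (hg a a n m h).1
  · obtain ⟨k, hk⟩ := Function.ne_iff.1 hab
    refine ((Set.finite_Iic k).image (g a)).subset ?_
    rintro _ ⟨⟨n, rfl⟩, ⟨m, hm⟩⟩
    refine ⟨n, ?_, rfl⟩
    by_contra hn
    exact hk ((hg a b n m hm.symm).2 k (not_le.1 hn))

/-! ### Thinning a double sequence -/

variable {W : Type*}

/-- Sets that strictly cut a sequence of ultrafilters one after the other yield disjoint sets. -/
theorem exists_pairwiseDisjoint_of_cut (H : Set ℕ) (V : ℕ → Set W) :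
    ∃ D : ℕ → Set W, H.PairwiseDisjoint D ∧ ∀ (u : Ultrafilter W), ∀ m,
      V m ∉ u → (∀ j ∈ H, j < m → V j ∈ u) → D m ∈ u := by
  refine ⟨fun m => {w | w ∉ V m ∧ ∀ j < m, j ∈ H → w ∈ V j}, ?_, ?_⟩
  · intro i hi j hj hij
    refine Set.disjoint_left.2 fun w h1 h2 => ?_
    rcases lt_or_gt_of_ne hij with h | h
    · exact h1.1 (h2.2 i h hi)
    · exact h2.1 (h1.2 j h hj)
  · intro u m h1 h2
    have h3 : ∀ᶠ w in (u : Filter W), ∀ j ∈ Iio m, j ∈ H → w ∈ V j :=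
      (eventually_all_finite (Set.finite_Iio m)).2 fun j hj =>
        Ultrafilter.eventually_imp.2 fun hjH => by
          have : j ∈ H := by
            by_contra hn
            simpa [hn] using hjH.exists
          exact h2 j this hj
    exact (Filter.Eventually.and (Ultrafilter.compl_mem_iff_notMem.2 h1) h3).mono
      fun w hw => ⟨hw.1, fun j hj => hw.2 j hj⟩

/-- A double sequence of ultrafilters can be thinned out so that each row is either constant or
separated by disjoint sets, and the whole double sequence is either constant or
separated by disjoint sets with respect to one of its indices. -/
theorem exists_thinning (f : ℕ → ℕ → Ultrafilter W) (L : Set W) :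
    ∃ H : Set ℕ, H.Infinite ∧
      (∃ B, (B = L ∨ B = Lᶜ) ∧ ∀ n ∈ H, ∀ m ∈ H, n < m → B ∈ f n m) ∧
      (∀ n ∈ H, (∀ m ∈ H, ∀ k ∈ H, n < m → n < k → f n m = f n k) ∨
        ∃ D : ℕ → Set W, H.PairwiseDisjoint D ∧ ∀ m ∈ H, n < m → D m ∈ f n m) ∧
      ((∃ z, ∀ n ∈ H, ∀ m ∈ H, n < m → f n m = z) ∨
        ∃ D : ℕ → Set W, H.PairwiseDisjoint D ∧
          ((∀ n ∈ H, ∀ m ∈ H, n < m → D m ∈ f n m) ∨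
            ∀ n ∈ H, ∀ m ∈ H, n < m → D n ∈ f n m)) := by
  obtain ⟨p, hp, -⟩ := exists_isFreeUltrafilter_mem Set.infinite_univ
  set y : ℕ → Ultrafilter W := fun n => p.bind (f n) with hy
  set x : Ultrafilter W := p.bind y with hx
  obtain ⟨B, hBL, hBx⟩ : ∃ B, (B = L ∨ B = Lᶜ) ∧ B ∈ x := by
    rcases Ultrafilter.mem_or_compl_mem x L with h | h
    exacts [⟨L, .inl rfl, h⟩, ⟨Lᶜ, .inr rfl, h⟩]
  -- Neighbourhoods of a limit that exclude a given term different from it: `V1` for the row limits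
  -- near `x`, `V2` for the entries of a row near its limit.
  have hV1 : ∀ n, ∃ V : Set W, V ∈ x ∧ (y n ≠ x → V ∉ y n) := fun n => by
    by_cases h : y n = x
    · exact ⟨univ, univ_mem, fun h' => (h' h).elim⟩
    · obtain ⟨V, h1, h2⟩ := exists_mem_notMem_of_ne (Ne.symm h)
      exact ⟨V, h1, fun _ => h2⟩
  have hV2 : ∀ n m, ∃ V : Set W, V ∈ y n ∧ (f n m ≠ y n → V ∉ f n m) := fun n m => by
    by_cases h : f n m = y n
    · exact ⟨univ, univ_mem, fun h' => (h' h).elim⟩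
    · obtain ⟨V, h1, h2⟩ := exists_mem_notMem_of_ne (Ne.symm h)
      exact ⟨V, h1, fun _ => h2⟩
  choose V1 hV1x hV1y using hV1
  choose V2 hV2y hV2f using hV2
  -- a set in `x` avoiding the entries of column `m` lying in rows that converge to `x`
  let V3 : ℕ → Set W := fun m => {w | ∀ n < m, y n = x → w ∈ V2 n m}
  have hV3 : ∀ m, V3 m ∈ x := fun m => by
    have : ∀ᶠ w in (x : Filter W), ∀ n ∈ Iio m, y n = x → w ∈ V2 n m :=
      (eventually_all_finite (Set.finite_Iio m)).2 fun n _ => by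
        by_cases h : y n = x
        · have := hV2y n m
          rw [h] at this
          exact Filter.mem_of_superset this fun w hw _ => hw
        · exact Eventually.of_forall fun w h' => (h h').elim
    exact this
  let const : ℕ → Prop := fun n => ∀ᶠ m in (p : Filter ℕ), f n m = y n
  have hR : ∀ n, ∀ᶠ m in (p : Filter ℕ), (B ∈ y n ↔ B ∈ f n m) ∧ (const n ↔ f n m = y n) ∧
      (∀ i ∈ Iic n, V2 i n ∈ f i m) ∧ V1 n ∈ y m ∧ (∀ j ∈ Iic n, (V1 j ∈ y n ↔ V1 j ∈ f n m)) ∧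
      (∀ i ∈ Iic n, ∀ j ∈ Iic n, y i = x → V3 j ∈ f i m) := by
    intro n
    refine (eventually_mem_iff_mem_bind p (f n) B).and (.and ?_ (.and ?_ (.and ?_ (.and ?_ ?_))))
    · by_cases h : const n
      · exact h.mono fun m hm => ⟨fun _ => hm, fun _ => h⟩
      · exact (Ultrafilter.eventually_not.2 h).mono
          fun m hm => ⟨fun h' => (h h').elim, fun h' => (hm h').elim⟩
    · exact (eventually_all_finite (Set.finite_Iic n)).2 fun i _ => hV2y i n
    · exact hV1x n
    · exact (eventually_all_finite (Set.finite_Iic n)).2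
        fun j _ => eventually_mem_iff_mem_bind p (f n) (V1 j)
    · refine (eventually_all_finite (Set.finite_Iic n)).2 fun i _ =>
        (eventually_all_finite (Set.finite_Iic n)).2 fun j _ => ?_
      by_cases h : y i = x
      · have := hV3 j
        rw [← h] at this
        exact (mem_bind_iff.1 this).mono fun m hm _ => hm
      · exact Eventually.of_forall fun m h' => (h h').elim
  -- Both dichotomies, `y n = x` or not and `const n` or not, are decided by `p`; only indices on
  -- the winning side are kept.
  have hA : {n | B ∈ y n ∧ (y n = x ∨ ∀ᶠ n in (p : Filter ℕ), y n ≠ x) ∧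
      (const n ∨ ∀ᶠ n in (p : Filter ℕ), ¬ const n) ∧
      ((∀ᶠ n in (p : Filter ℕ), y n ≠ x) → y n ≠ x) ∧
      ((∀ᶠ n in (p : Filter ℕ), ¬ const n) → ¬ const n)} ∈ p := by
    have key : ∀ P : ℕ → Prop, ∀ᶠ n in (p : Filter ℕ), (P n ∨ ∀ᶠ n in (p : Filter ℕ), ¬ P n) ∧
        ((∀ᶠ n in (p : Filter ℕ), ¬ P n) → ¬ P n) := fun P => by
      rcases Ultrafilter.em p P with h | h
      · refine h.mono fun n hn => ⟨.inl hn, fun h' => ?_⟩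
        exact ((h.and h').exists.elim fun _ h => (h.2 h.1).elim)
      · exact h.mono fun n hn => ⟨.inr h, fun _ => hn⟩
    have h0 : ∀ᶠ n in (p : Filter ℕ), B ∈ y n := hBx
    filter_upwards [h0, key (fun n => y n = x), key const] with n h1 h2 h3
    exact ⟨h1, h2.1, h3.1, h2.2, h3.2⟩
  obtain ⟨H, hHA, hH, hHR⟩ := exists_infinite_diagonal hp hA hR
  refine ⟨H, hH, ⟨B, hBL, fun n hn m hm hnm => (hHR n hn m hm hnm).1.1 (hHA hn).1⟩, ?_, ?_⟩
  · intro n hn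
    by_cases hc : const n
    · left
      intro m hm k hk h1 h2
      rw [(hHR n hn m hm h1).2.1.1 hc, (hHR n hn k hk h2).2.1.1 hc]
    · right
      obtain ⟨D, hD, hDu⟩ := exists_pairwiseDisjoint_of_cut (H ∩ Ioi n) (V2 n)
      refine ⟨fun m => if n < m then D m else ∅, ?_, fun m hm hnm => ?_⟩
      · intro i hi j hj hij
        by_cases h1 : n < i
        · by_cases h2 : n < j
          · simpa [Function.onFun, h1, h2] using hD ⟨hi, h1⟩ ⟨hj, h2⟩ hij
          · simp [Function.onFun, h2]
        · simp [Function.onFun, h1]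
      · simp only [if_pos hnm]
        refine hDu _ _ (hV2f n m fun h => hc ((hHR n hn m hm hnm).2.1.2 h)) ?_
        intro j hj hjm
        exact (hHR j hj.1 m hm hjm).2.2.1 n (mem_Iic.2 (le_of_lt hj.2))
  · by_cases hyx : ∀ᶠ n in (p : Filter ℕ), y n ≠ x
    · right
      -- Row limits differ from `x`, so the `V1` cut them apart; the entries of a row inherit the
      -- set of their limit.
      obtain ⟨D, hD, hDu⟩ := exists_pairwiseDisjoint_of_cut H V1
      refine ⟨D, hD, .inr fun n hn m hm hnm => hDu _ _ ?_ ?_⟩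
      · rw [← (hHR n hn m hm hnm).2.2.2.2.1 n self_mem_Iic]
        exact hV1y n ((hHA hn).2.2.2.1 hyx)
      · intro j hj hjn
        rw [← (hHR n hn m hm hnm).2.2.2.2.1 j hjn.le]
        exact (hHR j hj n hn hjn).2.2.2.1
    · have hyx' : ∀ n ∈ H, y n = x := fun n hn => (hHA hn).2.1.resolve_right hyx
      by_cases hc : ∀ᶠ n in (p : Filter ℕ), ¬ const n
      · right
        -- All rows converge to `x` without being constant, so the columns are cut apart instead.
        obtain ⟨D, hD, hDu⟩ := exists_pairwiseDisjoint_of_cut H V3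
        refine ⟨D, hD, .inl fun n hn m hm hnm => hDu _ _ ?_ ?_⟩
        · intro h
          refine hV2f n m (fun h' => (hHA hn).2.2.2.2 hc ((hHR n hn m hm hnm).2.1.2 h')) ?_
          exact Filter.mem_of_superset h fun w hw => hw n hnm (hyx' n hn)
        · intro j hj hjm
          rcases le_total n j with h | h
          · exact (hHR j hj m hm hjm).2.2.2.2.2 n h j self_mem_Iic (hyx' n hn)
          · exact (hHR n hn m hm hnm).2.2.2.2.2 n self_mem_Iic j h (hyx' n hn)
      · left
        refine ⟨x, fun n hn m hm hnm => ?_⟩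
        rw [(hHR n hn m hm hnm).2.1.1 ((hHA hn).2.2.1.resolve_right hc), hyx' n hn]

/-! ### Limits avoiding a small set -/

theorem bind_eq_of_eventually_eq {p : Ultrafilter ℕ} {u : ℕ → Ultrafilter W} {z : Ultrafilter W}
    (h : ∀ᶠ i in (p : Filter ℕ), u i = z) : p.bind u = z := by
  refine Ultrafilter.coe_le_coe.1 fun s hs => ?_
  exact mem_bind_iff.2 (h.mono fun i hi => by rw [hi]; exact hs)

/-- Limits of separated families along free ultrafilters concentrated on almost disjoint sets are
different. -/
theorem ne_of_mem_iUnion_of_almost_disjoint {H A B : Set ℕ} {D : ℕ → Set W}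
    (hD : H.PairwiseDisjoint D) (hA : A ⊆ H) (hB : B ⊆ H) (hAB : (A ∩ B).Finite)
    {u v : Ultrafilter W} (hu : ∀ F : Set ℕ, F.Finite → (⋃ i ∈ A \ F, D i) ∈ u)
    (hv : ∀ F : Set ℕ, F.Finite → (⋃ i ∈ B \ F, D i) ∈ v) : u ≠ v := by
  rintro rfl
  obtain ⟨w, h1, h2⟩ := Ultrafilter.nonempty_of_mem (inter_mem (hu _ hAB) (hv _ Set.finite_empty))
  simp only [mem_iUnion, exists_prop] at h1 h2
  obtain ⟨i, hi, hwi⟩ := h1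
  obtain ⟨j, hj, hwj⟩ := h2
  have hij : i ≠ j := fun h => hi.2 ⟨hi.1, h ▸ hj.1⟩
  exact Set.disjoint_left.1 (hD (hA hi.1) (hB hj.1) hij) hwi hwj

theorem iUnion_mem_bind {r : Ultrafilter ℕ} (hr : IsFreeUltrafilter r) {A : Set ℕ} (hA : A ∈ r)
    {D : ℕ → Set W} {u : ℕ → Ultrafilter W} {n : ℕ} (h : ∀ m ∈ A, n < m → D m ∈ u m)
    (F : Set ℕ) (hF : F.Finite) : (⋃ i ∈ A \ F, D i) ∈ r.bind u := by
  rw [mem_bind_iff]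
  filter_upwards [hA, hr.eventually_gt n, hr Fᶜ (by simpa using hF)] with m h1 h2 h3
  exact Filter.mem_of_superset (h m h1 h2) (subset_biUnion_of_mem (u := D) ⟨h1, h3⟩)

/-- For every double sequence of ultrafilters and every set `T` of fewer than continuum many
ultrafilters there is a free ultrafilter whose iterated limits avoid `T`, except for limits that
are terms of the double sequence. Moreover all limits can be taken to be on the same side of a
given set. -/
theorem exists_free_bind_avoiding {W : Type} (f : ℕ → ℕ → Ultrafilter W) (L : Set W)
    (T : Set (Ultrafilter W)) (hT : #T < 𝔠) :
    ∃ r : Ultrafilter ℕ, IsFreeUltrafilter r ∧ ∃ A ∈ r, ∃ B, (B = L ∨ B = Lᶜ) ∧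
      (∀ n ∈ A, B ∈ r.bind (f n) ∧
        (r.bind (f n) ∈ T → ∃ k l, k < l ∧ f k l = r.bind (f n))) ∧
      (r.bind fun n => r.bind (f n)) ∈ {x | B ∈ x ∧ (x ∈ T → ∃ k l, k < l ∧ f k l = x)} := by
  obtain ⟨H, hH, ⟨B, hBL, hB⟩, hrow, hlim⟩ := exists_thinning f L
  obtain ⟨A, hAH, hAinf, hAD⟩ := exists_almost_disjoint hH
  choose r hr hrA using fun a => exists_isFreeUltrafilter_mem (hAinf a)
  have hgt : ∀ a n, ∃ m ∈ A a, n < m := fun a n =>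
    (Filter.Eventually.and (hrA a) ((hr a).eventually_gt n)).exists
  have hBy : ∀ a, ∀ n ∈ A a, B ∈ (r a).bind (f n) := fun a n hn => by
    rw [mem_bind_iff]
    filter_upwards [hrA a, (hr a).eventually_gt n] with m h1 h2 using
      hB n (hAH a hn) m (hAH a h1) h2
  have hrow' : ∀ n ∈ H, (∀ a, ∃ k l, k < l ∧ f k l = (r a).bind (f n)) ∨
      ∀ a b, (r a).bind (f n) = (r b).bind (f n) → a = b := by
    intro n hn
    rcases hrow n hn with h | ⟨D, hD, h⟩
    · left
      intro a
      obtain ⟨m, hm, hnm⟩ := hgt a n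
      refine ⟨n, m, hnm, (bind_eq_of_eventually_eq ?_).symm⟩
      filter_upwards [hrA a, (hr a).eventually_gt n] with k h1 h2
      exact h k (hAH a h1) m (hAH a hm) h2 hnm
    · right
      intro a b hab
      by_contra hne
      exact ne_of_mem_iUnion_of_almost_disjoint hD (hAH a) (hAH b) (hAD a b hne)
        (iUnion_mem_bind (hr a) (hrA a) fun m hm => h m (hAH a hm))
        (iUnion_mem_bind (hr b) (hrA b) fun m hm => h m (hAH b hm)) hab
  let x : (ℕ → Bool) → Ultrafilter W := fun a => (r a).bind fun n => (r a).bind (f n)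
  have hlim' : (∀ a, ∃ k l, k < l ∧ f k l = x a) ∨ ∀ a b, x a = x b → a = b := by
    rcases hlim with ⟨z, hz⟩ | ⟨D, hD, h⟩
    · left
      intro a
      obtain ⟨n, hn, -⟩ := hgt a 0
      obtain ⟨m, hm, hnm⟩ := hgt a n
      refine ⟨n, m, hnm, (hz n (hAH a hn) m (hAH a hm) hnm).trans
        (bind_eq_of_eventually_eq ?_).symm⟩
      filter_upwards [hrA a] with i hi
      refine bind_eq_of_eventually_eq ?_
      filter_upwards [hrA a, (hr a).eventually_gt i] with j h1 h2
      exact hz i (hAH a hi) j (hAH a h1) h2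
    · right
      have hmem : ∀ a (F : Set ℕ), F.Finite → (⋃ i ∈ A a \ F, D i) ∈ x a := by
        intro a F hF
        rcases h with h | h
        · refine mem_bind_iff.2 (Filter.mem_of_superset (hrA a) fun n hn => ?_)
          exact iUnion_mem_bind (hr a) (hrA a) (fun m hm => h n (hAH a hn) m (hAH a hm)) F hF
        · refine iUnion_mem_bind (hr a) (hrA a) (n := 0) (fun n hn _ => ?_) F hF
          refine mem_bind_iff.2 ?_
          filter_upwards [hrA a, (hr a).eventually_gt n] with m h1 h2
          exact h n (hAH a hn) m (hAH a h1) h2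
      intro a b hab
      by_contra hne
      exact ne_of_mem_iUnion_of_almost_disjoint hD (hAH a) (hAH b) (hAD a b hne)
        (hmem a) (hmem b) hab
  obtain ⟨a, ha⟩ : ∃ a, (∀ n ∈ A a, (r a).bind (f n) ∈ T →
      ∃ k l, k < l ∧ f k l = (r a).bind (f n)) ∧ (x a ∈ T → ∃ k l, k < l ∧ f k l = x a) := by
    by_contra! hbad
    -- The tag records which limit fails for `a`: `none` for the double limit, `some n` for that of
    -- row `n`. A failing limit is not a term, so it determines `a` among indices with the same tag.
    have hbad' : ∀ a, ∃ q : Option ℕ × T,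
        (q.1 = none ∧ x a = q.2 ∧ ¬ ∃ k l, k < l ∧ f k l = x a) ∨
        ∃ n ∈ A a, q.1 = some n ∧ (r a).bind (f n) = q.2 ∧
          ¬ ∃ k l, k < l ∧ f k l = (r a).bind (f n) := by
      intro a
      by_cases h : ∀ n ∈ A a, (r a).bind (f n) ∈ T → ∃ k l, k < l ∧ f k l = (r a).bind (f n)
      · obtain ⟨h1, h2⟩ := hbad a h
        refine ⟨(none, ⟨_, h1⟩), .inl ⟨rfl, rfl, ?_⟩⟩
        push Not
        exact h2
      · push Not at h
        obtain ⟨n, hn, h1, h2⟩ := h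
        refine ⟨(some n, ⟨_, h1⟩), .inr ⟨n, hn, rfl, rfl, ?_⟩⟩
        push Not
        exact h2
    choose q hq using hbad'
    have hinj : Function.Injective q := by
      intro a b hab
      rcases hq a with ⟨h1, h2, h3⟩ | ⟨n, hn, h1, h2, h3⟩ <;>
        rcases hq b with ⟨h1', h2', h3'⟩ | ⟨n', hn', h1', h2', h3'⟩
      · rcases hlim' with h | h
        · exact (h3 (h a)).elim
        · exact h a b (by rw [h2, h2', hab])
      · rw [hab, h1'] at h1; cases h1
      · rw [hab, h1'] at h1; cases h1
      · rw [hab, h1'] at h1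
        cases h1
        rcases hrow' n (hAH a hn) with h | h
        · exact (h3 (h a)).elim
        · exact h a b (by rw [h2, h2', hab])
    have hle : #(ℕ → Bool) ≤ #(Option ℕ × T) := mk_le_of_injective hinj
    have hlt : #(Option ℕ × T) < 𝔠 := by
      rw [mk_prod]
      exact mul_lt_of_lt aleph0_le_continuum (by simpa using aleph0_lt_continuum) (by simpa using hT)
    have heq : #(ℕ → Bool) = 𝔠 := by simp
    exact (hle.trans_lt hlt).ne heq
  refine ⟨r a, hr a, A a, hrA a, B, hBL, fun n hn => ⟨hBy a n hn, ha.1 n hn⟩, ?_, ha.2⟩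
  exact mem_bind_iff.2 (Filter.mem_of_superset (hrA a) fun n hn => hBy a n hn)

/-! ### Adding one double limit -/

/-- The ultrafilter `x` and the sequence `y` form a double limit of `f` along a free ultrafilter;
both are listed by the sequence `z`. -/
def ListsDoubleLimit {W : Type*} (f : ℕ → ℕ → Ultrafilter W) (z : ℕ → Ultrafilter W) : Prop :=
  ∃ r : Ultrafilter ℕ, IsFreeUltrafilter r ∧ ∃ A ∈ r, (∀ n ∈ A, r.bind (f n) ∈ range z) ∧
    (r.bind fun n => r.bind (f n)) ∈ range z

/-- A set of ultrafilters meets its image under `τ` in principal ultrafilters only. -/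
def AlmostDisjointFromImage {W : Type*} (τ : W → W) (S : Set (Ultrafilter W)) : Prop :=
  ∀ u ∈ S, u.map τ ∈ S → u ∈ range (pure : W → Ultrafilter W)

/-- A new limit whose `τ`-image is in `S` is a term of `f`, hence already in `S`. Two new limits are
never swapped by `τ`, since all lie on one side of `L` and `τ` exchanges the sides. -/
theorem exists_listsDoubleLimit {W : Type} {τ : W → W} (hτ : Function.Involutive τ) {L : Set W}
    (hL : ∀ w, w ∈ L ↔ τ w ∉ L) {S : Set (Ultrafilter W)} (hS : AlmostDisjointFromImage τ S)
    (hcard : #S < 𝔠) {f : ℕ → ℕ → Ultrafilter W} (hf : ∀ n m, n < m → f n m ∈ S) :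
    ∃ z, ListsDoubleLimit f z ∧ AlmostDisjointFromImage τ (S ∪ range z) := by
  have hττ : ∀ u : Ultrafilter W, (u.map τ).map τ = u := fun u => by
    rw [Ultrafilter.map_map, hτ.comp_self, Ultrafilter.map_id]
  have hTcard : #{u : Ultrafilter W | u.map τ ∈ S} < 𝔠 := by
    refine lt_of_le_of_lt (mk_le_of_injective
      (f := fun u : {u : Ultrafilter W | u.map τ ∈ S} => (⟨u.1.map τ, u.2⟩ : S)) ?_) hcard
    intro u v huv
    have := congrArg (fun s : S => s.1.map τ) huv
    simp only [hττ] at this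
    exact Subtype.ext this
  obtain ⟨r, hr, A, hA, B, hB, hy, hx⟩ := exists_free_bind_avoiding f L _ hTcard
  classical
  let x := r.bind fun n => r.bind (f n)
  let z : ℕ → Ultrafilter W := fun k => if k ∈ A then r.bind (f k) else x
  have hz : ∀ u ∈ range z ∪ {x}, B ∈ u ∧ (u.map τ ∈ S → u ∈ S) := by
    have hx' : B ∈ x ∧ (x.map τ ∈ S → x ∈ S) := by
      refine ⟨hx.1, fun h => ?_⟩
      obtain ⟨k, l, hkl, h1⟩ := hx.2 h
      exact (show f k l = x from h1) ▸ hf k l hkl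
    rintro u (⟨k, rfl⟩ | rfl)
    · by_cases hk : k ∈ A
      · simp only [z, if_pos hk]
        refine ⟨(hy k hk).1, fun h => ?_⟩
        obtain ⟨i, l, hil, h1⟩ := (hy k hk).2 h
        exact h1 ▸ hf i l hil
      · simpa only [z, if_neg hk] using hx'
    · exact hx'
  -- The double limit is put in front, as `A` may leave no index free for it.
  let z' : ℕ → Ultrafilter W := fun k => Nat.casesOn k x z
  have hz' : range z' ⊆ range z ∪ {x} := by
    rintro _ ⟨k, rfl⟩
    cases k with
    | zero => exact .inr rfl
    | succ k => exact .inl ⟨k, rfl⟩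
  refine ⟨z', ⟨r, hr, A, hA, fun n hn => ⟨n + 1, if_pos hn⟩, ⟨0, rfl⟩⟩, ?_⟩
  rintro u (hu | hu) (hv | hv)
  · exact hS u hu hv
  · refine hS u hu ((hz _ (hz' hv)).2 ?_)
    rwa [hττ]
  · exact hS u ((hz _ (hz' hu)).2 hv) hv
  · exfalso
    obtain ⟨w, h1, h2⟩ := Ultrafilter.nonempty_of_mem
      (inter_mem (hz _ (hz' hu)).1 (Ultrafilter.mem_map.1 (hz _ (hz' hv)).1))
    rcases hB with rfl | rfl
    · exact (hL w).1 h1 h2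
    · exact h1 ((hL w).2 h2)

/-! ### Transfinite recursion of length continuum -/

/-- Bookkeeping: a well-order of type continuum lists all double sequences on itself in such
a way that each of them is listed after all of its terms. -/
theorem exists_bookkeeping (I V : Type) [LinearOrder I] [WellFoundedLT I]
    (hI : #I = 𝔠) (hIio : ∀ i : I, #(Iio i) < 𝔠) (hV : #V ≤ 𝔠) :
    ∃ e : I → ℕ → ℕ → V ⊕ I × ℕ, ∀ g : ℕ → ℕ → V ⊕ I × ℕ, ∃ a, e a = g ∧
      ∀ n m b k, g n m = .inr (b, k) → b < a := by
  have hcode : #(V ⊕ I × ℕ) ≤ 𝔠 := by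
    simp only [mk_sum, mk_prod, lift_id, hI, mk_nat]
    exact add_le_of_le aleph0_le_continuum hV (by simp)
  have hfun : #((ℕ → ℕ → V ⊕ I × ℕ) × I) ≤ #I := by
    have h1 : #(ℕ → ℕ → V ⊕ I × ℕ) ≤ 𝔠 := by
      simp only [← power_def, mk_nat]
      calc (#(V ⊕ I × ℕ) ^ ℵ₀) ^ ℵ₀ ≤ (𝔠 ^ ℵ₀) ^ ℵ₀ :=
            power_le_power_right (power_le_power_right hcode)
        _ = 𝔠 := by simp
    rw [mk_prod, lift_id, lift_id, hI]
    exact (mul_le_mul_left h1 𝔠).trans (by simp)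
  have hne : Nonempty I := mk_ne_zero_iff.1 (by rw [hI]; exact continuum_ne_zero)
  obtain ⟨s⟩ := hfun
  obtain ⟨i0⟩ := hne
  have : Nonempty ((ℕ → ℕ → V ⊕ I × ℕ) × I) := ⟨⟨fun _ _ => .inr (i0, 0), i0⟩⟩
  obtain ⟨t, ht⟩ : ∃ t : I → (ℕ → ℕ → V ⊕ I × ℕ) × I, Function.LeftInverse t s :=
    ⟨_, Function.leftInverse_invFun s.injective⟩
  refine ⟨fun a => (t a).1, fun g => ?_⟩
  by_contra! hbad
  have hq : ∀ i : I, ∃ n m b k, g n m = .inr (b, k) ∧ s (g, i) ≤ b :=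
    fun i => hbad (s (g, i)) (by rw [ht])
  choose n m b k hg hle using hq
  let c : ℕ × ℕ → I := fun q => (g q.1 q.2).elim (fun _ => i0) Prod.fst
  -- Each `g` is listed at continuum many stages; if all came too early, countably many initial
  -- segments would cover them, against König's inequality.
  have hcover : (Set.range fun i => s (g, i)) ⊆ ⋃ q : ℕ × ℕ, Iic (c q) := by
    rintro _ ⟨i, rfl⟩
    refine mem_iUnion.2 ⟨(n i, m i), ?_⟩
    simp only [c, hg, Sum.elim_inr]
    exact hle i
  have hIic : ∀ i : I, #(Iic i) < 𝔠 := fun i => by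
    rw [← Iio_union_right]
    exact (mk_union_le _ _).trans_lt (add_lt_of_lt aleph0_le_continuum (hIio i)
      (by rw [mk_singleton]; exact one_lt_aleph0.trans aleph0_lt_continuum))
  have h1 : #(⋃ q : ℕ × ℕ, Iic (c q)) < 𝔠 := by
    calc #(⋃ q : ℕ × ℕ, Iic (c q)) ≤ Cardinal.sum fun q => #(Iic (c q)) := mk_iUnion_le_sum_mk
      _ < Cardinal.prod fun _ : ℕ × ℕ => 𝔠 := sum_lt_prod _ _ fun q => hIic _
      _ = 𝔠 := by simp
  have h2 : #(Set.range fun i => s (g, i)) = 𝔠 := by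
    rw [mk_range_eq _ (fun i j h => congrArg Prod.snd (s.injective h)), hI]
  exact (h2 ▸ mk_le_mk_of_subset hcover).not_gt h1

theorem biUnion_lt_union_self {I α : Type*} [LinearOrder I] (s : I → Set α) (a : I) :
    (⋃ b < a, s b) ∪ s a = ⋃ b ≤ a, s b := by
  ext x
  simp only [mem_union, mem_iUnion, exists_prop, le_iff_lt_or_eq]
  grind

/-- A nonprincipal `u` and its image enter at two stages, so both are present at the later one. -/
theorem almostDisjointFromImage_union_iUnion {W : Type*} {τ : W → W} (hτ : Function.Involutive τ)
    {I : Type*} [LinearOrder I] {P : I → Prop} {Φ : I → ℕ → Ultrafilter W}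
    (h : ∀ a, P a → AlmostDisjointFromImage τ (range pure ∪ ⋃ b ≤ a, range (Φ b))) :
    AlmostDisjointFromImage τ (range pure ∪ ⋃ (b) (_ : P b), range (Φ b)) := by
  rintro u (hu | hu) hv
  · exact hu
  rcases hv with ⟨w, hw⟩ | hv
  · refine ⟨τ w, ?_⟩
    rw [← Ultrafilter.map_pure, hw, Ultrafilter.map_map, hτ.comp_self, Ultrafilter.map_id]
  · simp only [mem_iUnion, exists_prop] at hu hv
    obtain ⟨a, ha, hu⟩ := hu
    obtain ⟨b, hb, hv⟩ := hv
    have hab : P (max a b) := by rcases max_choice a b with h | h <;> rw [h] <;> assumption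
    refine h _ hab u (.inr ?_) (.inr ?_)
    · exact mem_biUnion (le_max_left a b : a ∈ {c | c ≤ max a b}) hu
    · exact mem_biUnion (le_max_right a b : b ∈ {c | c ≤ max a b}) hv

/-- The value at stage `a` of a transfinite sequence, replaced by a principal ultrafilter if it is
not yet available. -/
noncomputable def earlier {W I : Type} [Inhabited W] [LinearOrder I] (Φ : I → ℕ → Ultrafilter W)
    (a b : I) (k : ℕ) : Ultrafilter W :=
  open Classical in if b < a then Φ b k else pure default

/-- The sequence of ultrafilters coded by `c` at stage `a`. -/
noncomputable def decode {W I : Type} [Inhabited W] [LinearOrder I] (Φ : I → ℕ → Ultrafilter W)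
    (a : I) (c : W ⊕ I × ℕ) : Ultrafilter W :=
  c.elim pure fun q => earlier Φ a q.1 q.2

/-- Choosing by `epsilon` separates the recursion from the proof that each stage is solvable, which
can then use induction on the stages. -/
theorem exists_recursive_sequence {W I : Type} [Inhabited W] [LinearOrder I] [WellFoundedLT I]
    (Q : I → (I → ℕ → Ultrafilter W) → (ℕ → Ultrafilter W) → Prop) :
    ∃ Φ : I → ℕ → Ultrafilter W, ∀ a, (∃ z, Q a (earlier Φ a) z) → Q a (earlier Φ a) (Φ a) := by
  classical
  let F : ∀ a : I, (∀ b, b < a → ℕ → Ultrafilter W) → ℕ → Ultrafilter W := fun a prev =>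
    Classical.epsilon (Q a fun b k => if h : b < a then prev b h k else pure default)
  refine ⟨wellFounded_lt.fix F, fun a ha => ?_⟩
  rw [wellFounded_lt.fix_eq F a]
  have heq : (fun (b : I) (k : ℕ) => if h : b < a then wellFounded_lt.fix F b k else pure default)
      = earlier (wellFounded_lt.fix F) a := by
    funext b k
    simp [earlier]
  have : F a (fun b _ => wellFounded_lt.fix F b)
      = Classical.epsilon (Q a (earlier (wellFounded_lt.fix F) a)) := by
    rw [← heq]
  rw [this]
  exact Classical.epsilon_spec ha

/-- A set of ultrafilters closed under taking some double limits that is almost disjoint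
from its image under an involution. -/
theorem exists_almostDisjoint_closed {W : Type} [Inhabited W] [Countable W] {τ : W → W}
    (hτ : Function.Involutive τ) {L : Set W} (hL : ∀ w, w ∈ L ↔ τ w ∉ L) :
    ∃ Z : Set (Ultrafilter W), range pure ⊆ Z ∧ AlmostDisjointFromImage τ Z ∧
      ∀ f : ℕ → ℕ → Ultrafilter W, (∀ n m, f n m ∈ Z) →
        ∃ z, ListsDoubleLimit f z ∧ range z ⊆ Z := by
  let I := (𝔠 : Cardinal.{0}).ord.ToType
  have hI : #I = 𝔠 := mk_ord_toType _
  have hIio : ∀ i : I, #(Iio i) < 𝔠 := fun i => by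
    simpa [hI] using mk_Iio_lt i (by simp [I])
  have hW : #W ≤ ℵ₀ := mk_le_aleph0
  obtain ⟨e, he⟩ := exists_bookkeeping I W hI hIio (hW.trans aleph0_le_continuum)
  obtain ⟨Φ, hΦ⟩ := exists_recursive_sequence (W := W) (I := I) fun a Ψ z =>
    ListsDoubleLimit (fun n m => (e a n m).elim pure fun q => Ψ q.1 q.2) z ∧
      AlmostDisjointFromImage τ ((range pure ∪ ⋃ b < a, range (Ψ b)) ∪ range z)
  have hearlier : ∀ a b, b < a → earlier Φ a b = Φ b := fun a b h => by
    funext k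
    simp [earlier, h]
  have hunion : ∀ a, (⋃ b < a, range (earlier Φ a b)) = ⋃ b < a, range (Φ b) := fun a =>
    iUnion₂_congr fun b hb => by rw [hearlier a b hb]
  have hstage : ∀ a, ListsDoubleLimit (fun n m => decode Φ a (e a n m)) (Φ a) ∧
      AlmostDisjointFromImage τ ((range pure ∪ ⋃ b < a, range (Φ b)) ∪ range (Φ a)) := by
    intro a
    induction a using WellFoundedLT.induction with
    | ind a ih =>
      have h := hΦ a
      rw [hunion] at h
      refine h (exists_listsDoubleLimit hτ hL ?_ ?_ ?_)
      · refine almostDisjointFromImage_union_iUnion (P := fun b => b < a) hτ fun b hb => ?_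
        have := (ih b hb).2
        rwa [union_assoc, biUnion_lt_union_self] at this
      · refine (mk_union_le _ _).trans_lt (add_lt_of_lt aleph0_le_continuum ?_ ?_)
        · exact (mk_range_le.trans hW).trans_lt aleph0_lt_continuum
        · have : (⋃ b < a, range (Φ b)) = range fun q : Iio a × ℕ => Φ q.1 q.2 := by
            ext u
            simp
          rw [this]
          refine mk_range_le.trans_lt ?_
          rw [mk_prod, lift_id, lift_id, mk_nat]
          exact mul_lt_of_lt aleph0_le_continuum (hIio a) aleph0_lt_continuum
      · intro n m _
        rcases e a n m with w | ⟨b, k⟩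
        · exact .inl ⟨w, rfl⟩
        · by_cases hb : b < a
          · refine .inr (mem_biUnion (show b ∈ {c | c < a} from hb) ⟨k, ?_⟩)
            simp [earlier, hb]
          -- A code naming a stage not yet reached decodes to a principal ultrafilter, which is
          -- available.
          · exact .inl ⟨default, by simp [earlier, hb]⟩
  refine ⟨range pure ∪ ⋃ (b) (_ : True), range (Φ b), subset_union_left, ?_, ?_⟩
  · refine almostDisjointFromImage_union_iUnion hτ fun b _ => ?_
    have := (hstage b).2
    rwa [union_assoc, biUnion_lt_union_self] at this
  · intro f hf
    have hcode : ∀ n m, ∃ c : W ⊕ I × ℕ, f n m = c.elim pure fun q => Φ q.1 q.2 := by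
      intro n m
      rcases hf n m with ⟨w, hw⟩ | h
      · exact ⟨.inl w, hw.symm⟩
      · simp only [mem_iUnion] at h
        obtain ⟨b, -, k, hk⟩ := h
        exact ⟨.inr (b, k), hk.symm⟩
    choose g hg using hcode
    obtain ⟨a, rfl, ha⟩ := he g
    refine ⟨Φ a, ?_, fun u hu => .inr (mem_iUnion₂.2 ⟨a, trivial, hu⟩)⟩
    have : f = fun n m => decode Φ a (e a n m) := by
      funext n m
      rw [hg]
      rcases h : e a n m with w | ⟨b, k⟩
      · rfl
      · simp [decode, earlier, ha n m b k h]
    rw [this]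
    exact (hstage a).1

/-! ### The space and its square -/

theorem isPLimit_of_bind_eq {W : Type*} {Z : Set (Ultrafilter W)} {r : Ultrafilter ℕ} {A : Set ℕ}
    (hA : A ∈ r) (s : A → Z) (x : Z) (u : ℕ → Ultrafilter W)
    (hs : ∀ n : A, (s n : Ultrafilter W) = u n) (hx : r.bind u = x) : IsPLimit r s x := by
  intro U hU hxU
  obtain ⟨O, hO, rfl⟩ := isOpen_induced_iff.1 hU
  obtain ⟨_, ⟨t, rfl⟩, ht, htO⟩ := ultrafilterBasis_is_basis.exists_subset_of_mem_open hxU hO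
  have h : t ∈ r.bind u := by rw [hx]; exact ht
  refine Filter.mem_of_superset (inter_mem hA (mem_bind_iff.1 h)) fun n hn => ⟨hn.1, htO ?_⟩
  change t ∈ (s ⟨n, hn.1⟩ : Ultrafilter W)
  rw [hs]
  exact hn.2

theorem doublyCountablyCompact_of_listsDoubleLimit {W : Type*} {Z : Set (Ultrafilter W)}
    [Nonempty Z]
    (hZ : ∀ f : ℕ → ℕ → Ultrafilter W, (∀ n m, f n m ∈ Z) →
      ∃ z, ListsDoubleLimit f z ∧ range z ⊆ Z) : DoublyCountablyCompact Z := by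
  classical
  intro f
  -- Values outside `n < m` do not matter, because `r` is free.
  let g : ℕ → ℕ → Z := fun n m => if h : n < m then f n ⟨m, h⟩ else Classical.arbitrary Z
  obtain ⟨z, ⟨r, hr, A, hA, hy, hx⟩, hz⟩ := hZ (fun n m => g n m) fun n m => (g n m).2
  refine ⟨r, hr, ⟨_, hz hx⟩, A, hA, fun n => ⟨_, hz (hy n n.2)⟩, fun n => ?_, ?_⟩
  · refine isPLimit_of_bind_eq (hr.eventually_gt n) _ _ (fun m => g n m) (fun m => ?_) rfl
    have : (n : ℕ) < m := m.2
    simp only [g, dif_pos this]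
    rfl
  · exact isPLimit_of_bind_eq hA _ _ (fun n => r.bind fun m => g n m) (fun n => rfl) rfl

theorem not_countablyCompactSpace_prod {W : Type*} {τ : W → W} {Z : Set (Ultrafilter W)}
    (hpure : range pure ⊆ Z) (hZ : AlmostDisjointFromImage τ Z) [Infinite W] :
    ¬ CountablyCompactSpace (Z × Z) := by
  intro h
  let w := Infinite.natEmbedding W
  let s : ℕ → Z × Z := fun n => (⟨pure (w n), hpure ⟨_, rfl⟩⟩, ⟨pure (τ (w n)), hpure ⟨_, rfl⟩⟩)
  obtain ⟨⟨⟨u, hu⟩, ⟨v, hv⟩⟩, -, hq⟩ :=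
    isCountablyCompact_iff_seq_clusterPt.1 h.isCountablyCompact_univ s
      (Eventually.of_forall fun _ => mem_univ _)
  rw [mapClusterPt_iff_frequently] at hq
  have hfreq : ∀ a b : Set W, a ∈ u → b ∈ v → ∃ᶠ n in atTop, w n ∈ a ∧ τ (w n) ∈ b := by
    intro a b ha hb
    have hopen : IsOpen {q : Z × Z | a ∈ q.1.1 ∧ b ∈ q.2.1} :=
      ((ultrafilter_isOpen_basic a).preimage (continuous_subtype_val.comp continuous_fst)).inter
        ((ultrafilter_isOpen_basic b).preimage (continuous_subtype_val.comp continuous_snd))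
    exact (hq _ (hopen.mem_nhds ⟨ha, hb⟩)).mono fun n hn => hn
  have huv : u.map τ = v := by
    by_contra hne
    obtain ⟨b, h1, h2⟩ := exists_mem_notMem_of_ne hne
    obtain ⟨n, hn⟩ := (hfreq (τ ⁻¹' b) bᶜ h1 (Ultrafilter.compl_mem_iff_notMem.2 h2)).exists
    exact hn.2 hn.1
  -- So `u` is principal at some `i`, a point that the injective sequence `w` visits at most once.
  obtain ⟨i, rfl⟩ := hZ u hu (huv ▸ hv)
  have h1 := hfreq {i} univ (Ultrafilter.mem_pure.2 rfl) univ_mem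
  refine (Nat.frequently_atTop_iff_infinite.1 h1) (Set.Subsingleton.finite fun n hn m hm => ?_)
  exact w.injective ((mem_singleton_iff.1 hn.1).trans (mem_singleton_iff.1 hm.1).symm)

/-- There is, without further hypotheses, a Tychonoff doubly countably compact space whose square
is not countably compact. -/
theorem exists_doublyCountablyCompact_square_not_countablyCompact :
    ∃ (X : Type) (_ : TopologicalSpace X),
      T35Space X ∧ DoublyCountablyCompact X ∧ ¬ CountablyCompactSpace (X × X) := by
  have hτ : Function.Involutive (Prod.map id not : ℕ × Bool → ℕ × Bool) := fun w => by
    cases w; simp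
  obtain ⟨Z, hpure, hZ, hlim⟩ :=
    exists_almostDisjoint_closed hτ (L := {w | w.2 = true}) fun w => by simp
  have : Nonempty Z := ⟨⟨_, hpure ⟨default, rfl⟩⟩⟩
  exact ⟨Z, inferInstance, inferInstance, doublyCountablyCompact_of_listsDoubleLimit hlim,
    not_countablyCompactSpace_prod hpure hZ⟩

end DoubleLimit

/-- The hypothesis is not used: the construction above works in ZFC. -/
theorem mainTheorem1 (hRamsey : ∃ p : Ultrafilter ℕ, IsRamseyUltrafilter p) :
    ∃ (X : Type) (_ : TopologicalSpace X),
      T35Space X ∧ DoublyCountablyCompact X ∧ ¬ CountablyCompactSpace (X × X) :=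
  DoubleLimit.exists_doublyCountablyCompact_square_not_countablyCompact
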